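/- Let $\Bbbk$ be a field of characteristic zero. Let $A$ be a (not necessarily commutative) domain that is finitely generated as a $\Bbbk$-algebra and has finite Gelfand-Kirillov dimension $$\operatorname{GKdim} A=\sup_V\ \limsup_{n\to\infty}\ \log_n(\dim_{\Bbbk} V^n)<\infty ,$$ where $V$ runs over all finite dimensional subspaces of $A$. Suppose that the Makar-Limanov invariant $$ML(A)=\bigcap_{\partial}\ker\partial ,$$ where $\partial$ runs over all locally nilpotent $\Bbbk$-linear derivations of $A$ (that is, those such that for every $a\in A$ there is $n\ge 0$ with $\partial^n(a)=0$), is equal to $A$. Then $A$ is $\delta$-cancellative: for every $\Bbbk$-algebra $B$, every $\Bbbk$-linear derivation $\delta$ of $A$ and every $\Bbbk$-linear derivation $\delta'$ of $B$, if there is an isomorphism of $\Bbbk$-algebras $A[s;\delta]\cong B[t;\delta']$, then $A\cong B$ as $\Bbbk$-algebras. Here algebras are associative and unital, and $A[s;\delta]$ denotes the Ore extension with trivial automorphism: the free left $A$-module on the powers of $s$, with multiplication determined by $sa=as+\delta(a)$ for $a\in A$. -/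

import Mathlib

open Filter

universe u v w

/-- A `k`-linear derivation of a (not necessarily commutative) `k`-algebra `A`. -/
structure AlgDerivation (k : Type u) (A : Type v) [CommRing k] [Ring A] [Algebra k A]
    extends A →ₗ[k] A where
  leibniz' : ∀ a b : A, toFun (a * b) = toFun a * b + a * toFun b

namespace AlgDerivation

variable {k : Type u} {A : Type v} [CommRing k] [Ring A] [Algebra k A]

instance : CoeFun (AlgDerivation k A) (fun _ => A → A) := ⟨fun δ => δ.toLinearMap⟩

theorem leibniz (δ : AlgDerivation k A) (a b : A) : δ (a * b) = δ a * b + a * δ b :=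
  δ.leibniz' a b

theorem map_one_eq_zero (δ : AlgDerivation k A) : δ 1 = 0 := by
  have h := δ.leibniz 1 1
  simpa using h

theorem map_algebraMap_eq_zero (δ : AlgDerivation k A) (c : k) : δ (algebraMap k A c) = 0 := by
  rw [Algebra.algebraMap_eq_smul_one, map_smul, map_one_eq_zero, smul_zero]

/-- The kernel `{a | δ a = 0}`, a `k`-subalgebra of `A`. -/
def ker (δ : AlgDerivation k A) : Subalgebra k A where
  carrier := {a | δ a = 0}
  mul_mem' := by
    intro a b (ha : δ a = 0) (hb : δ b = 0)
    change δ (a * b) = 0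
    rw [leibniz, ha, hb, zero_mul, mul_zero, add_zero]
  add_mem' := by
    intro a b (ha : δ a = 0) (hb : δ b = 0)
    change δ (a + b) = 0
    rw [map_add, ha, hb, add_zero]
  algebraMap_mem' := fun c => δ.map_algebraMap_eq_zero c

/-- `δ` is locally nilpotent: every `a : A` is killed by some power of `δ`. -/
def IsLocallyNilpotent (δ : AlgDerivation k A) : Prop :=
  ∀ a : A, ∃ n : ℕ, (δ.toLinearMap ^ n) a = 0

end AlgDerivation

/-- The Makar-Limanov invariant `ML(A)`: the intersection of the kernels of all locally nilpotent
`k`-linear derivations of `A`. -/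
def makarLimanov (k : Type u) (A : Type v) [CommRing k] [Ring A] [Algebra k A] :
    Subalgebra k A :=
  ⨅ (δ : AlgDerivation k A) (_ : δ.IsLocallyNilpotent), δ.ker

/-- The Gelfand-Kirillov dimension, with values in the extended reals: the supremum of
`limsup (log_n (dim V ^ n))` over the finite dimensional subspaces `V` of `A`, where `V ^ n` is
the span of the products of `n` elements of `V`. -/
noncomputable def gkDim (k : Type u) (A : Type v) [Field k] [Ring A] [Algebra k A] : EReal :=
  ⨆ (V : Submodule k A) (_ : FiniteDimensional k V),
    limsup (fun n : ℕ =>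
      ((Real.logb (n : ℝ) (Module.finrank k (V ^ n : Submodule k A) : ℝ) : ℝ) : EReal)) atTop

/-- The underlying additive group of the Ore extension `A[t; δ]` (with `σ = id`): an element is a
finite formal sum `∑ aₙ tⁿ`, with coefficients in `A` written on the left. -/
def OreExt {k : Type u} {A : Type v} [CommRing k] [Ring A] [Algebra k A]
    (_δ : AlgDerivation k A) : Type v := ℕ →₀ A

namespace OreExt

variable {k : Type u} {A : Type v} [CommRing k] [Ring A] [Algebra k A] (δ : AlgDerivation k A)

noncomputable instance : AddCommGroup (OreExt δ) := inferInstanceAs (AddCommGroup (ℕ →₀ A))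

noncomputable instance : Module k (OreExt δ) := inferInstanceAs (Module k (ℕ →₀ A))

/-- The element `a tⁿ`. -/
noncomputable def monomial (n : ℕ) (a : A) : OreExt δ := Finsupp.single n a

/-- Left multiplication by `t` on formal sums: `t · (b tᵐ) = b tᵐ⁺¹ + δ(b) tᵐ`. -/
noncomputable def mulT : Module.End k (ℕ →₀ A) :=
  Finsupp.lmapDomain A k Nat.succ + Finsupp.mapRange.linearMap δ.toLinearMap

/-- Left multiplication on formal sums: `∑ aₙ tⁿ` acts as `∑ aₙ · (t · )ⁿ`. -/
noncomputable def mulLeft : (ℕ →₀ A) →ₗ[k] Module.End k (ℕ →₀ A) :=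
  Finsupp.lsum k fun n =>
    LinearMap.mulRight k (mulT δ ^ n) ∘ₗ (Algebra.lsmul k k (ℕ →₀ A)).toLinearMap

theorem mulT_single (m : ℕ) (b : A) :
    mulT δ (Finsupp.single m b) = Finsupp.single (m + 1) b + Finsupp.single m (δ b) := by
  simp [mulT, Finsupp.mapDomain_single]

theorem mulLeft_single (n : ℕ) (a : A) (g : ℕ →₀ A) :
    mulLeft δ (Finsupp.single n a) g = a • (mulT δ ^ n) g := by
  simp [mulLeft]

theorem mulT_smul (a : A) (g : ℕ →₀ A) : mulT δ (a • g) = a • mulT δ g + δ a • g := by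
  induction g using Finsupp.induction_linear with
  | zero => simp
  | add f g hf hg => rw [smul_add, map_add, hf, hg, map_add, smul_add, smul_add]; abel
  | single m b =>
    simp only [Finsupp.smul_single, smul_eq_mul, mulT_single, AlgDerivation.leibniz, smul_add,
      Finsupp.single_add]
    abel

theorem mulLeft_smul (a : A) (f g : ℕ →₀ A) : mulLeft δ (a • f) g = a • mulLeft δ f g := by
  induction f using Finsupp.induction_linear with
  | zero => simp
  | add p q hp hq => simp only [smul_add, map_add, LinearMap.add_apply, hp, hq]
  | single m b => simp only [Finsupp.smul_single, smul_eq_mul, mulLeft_single, mul_smul]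

theorem mulLeft_mulT (f g : ℕ →₀ A) : mulLeft δ (mulT δ f) g = mulT δ (mulLeft δ f g) := by
  induction f using Finsupp.induction_linear with
  | zero => simp
  | add p q hp hq => simp only [map_add, LinearMap.add_apply, hp, hq]
  | single m b =>
    simp only [mulT_single, map_add, LinearMap.add_apply, mulLeft_single, mulT_smul, pow_succ',
      Module.End.mul_apply]

theorem mulLeft_mulT_pow (n : ℕ) (f g : ℕ →₀ A) :
    mulLeft δ ((mulT δ ^ n) f) g = (mulT δ ^ n) (mulLeft δ f g) := by
  induction n with
  | zero => simp
  | succ n ih => simp only [pow_succ', Module.End.mul_apply, mulLeft_mulT, ih]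

theorem mulLeft_mulLeft (f g h : ℕ →₀ A) :
    mulLeft δ (mulLeft δ f g) h = mulLeft δ f (mulLeft δ g h) := by
  induction f using Finsupp.induction_linear with
  | zero => simp
  | add p q hp hq => simp only [map_add, LinearMap.add_apply, hp, hq]
  | single n a => simp only [mulLeft_single, mulLeft_smul, mulLeft_mulT_pow]

theorem mulLeft_one_left (f : ℕ →₀ A) : mulLeft δ (Finsupp.single 0 1) f = f := by
  simp [mulLeft_single]

theorem mulLeft_one_right (f : ℕ →₀ A) : mulLeft δ f (Finsupp.single 0 1) = f := by
  have hpow (n : ℕ) : (mulT δ ^ n) (Finsupp.single 0 1) = Finsupp.single n (1 : A) := by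
    induction n with
    | zero => simp
    | succ n ih =>
      simp [pow_succ', Module.End.mul_apply, ih, mulT_single, AlgDerivation.map_one_eq_zero]
  induction f using Finsupp.induction_linear with
  | zero => simp
  | add p q hp hq => simp only [map_add, LinearMap.add_apply, hp, hq]
  | single n a => simp [mulLeft_single, hpow]

/-- The ring `A[t; δ]`. -/
noncomputable instance : Ring (OreExt δ) :=
  { (inferInstance : AddCommGroup (OreExt δ)) with
    mul := fun f g => mulLeft δ f g
    one := monomial δ 0 1
    left_distrib := fun f g h => map_add (mulLeft δ f) g h
    right_distrib := fun f g h => LinearMap.congr_fun (map_add (mulLeft δ) f g) h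
    zero_mul := fun f => LinearMap.congr_fun (map_zero (mulLeft δ)) f
    mul_zero := fun f => map_zero (mulLeft δ f)
    mul_assoc := mulLeft_mulLeft δ
    one_mul := mulLeft_one_left δ
    mul_one := mulLeft_one_right δ }

noncomputable instance : Algebra k (OreExt δ) :=
  Algebra.ofModule
    (fun c f g => LinearMap.congr_fun (map_smul (mulLeft δ) c f) g)
    (fun c f g => map_smul (mulLeft δ f) c g)

/-- The coefficient embedding `A → A[t; δ]` is multiplicative. -/
theorem monomial_zero_mul_monomial (a b : A) (m : ℕ) :
    monomial δ 0 a * monomial δ m b = monomial δ m (a * b) := by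
  change mulLeft δ (Finsupp.single 0 a) (Finsupp.single m b) = Finsupp.single m (a * b)
  simp [mulLeft_single]

/-- The powers of the variable: `t · tⁿ = tⁿ⁺¹`. -/
theorem monomial_one_mul_monomial_one (n : ℕ) :
    monomial δ 1 1 * monomial δ n 1 = monomial δ (n + 1) 1 := by
  change mulLeft δ (Finsupp.single 1 1) (Finsupp.single n 1) = Finsupp.single (n + 1) 1
  simp [mulLeft_single, mulT_single, AlgDerivation.map_one_eq_zero]

/-- The defining relation of the Ore extension: `t a = a t + δ(a)`. -/
theorem variable_mul_coeff (a : A) :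
    monomial δ 1 1 * monomial δ 0 a =
      monomial δ 0 a * monomial δ 1 1 + monomial δ 0 (δ a) := by
  rw [monomial_zero_mul_monomial, mul_one]
  have h : mulLeft δ (Finsupp.single 1 1) (Finsupp.single 0 a) =
      Finsupp.single 1 a + Finsupp.single 0 (δ a) := by
    simp [mulLeft_single, mulT_single]
  exact h

end OreExt

/-- `A` is `δ`-cancellative: for every `k`-algebra `B` and all `k`-derivations `δ` of `A` and `δ'`
of `B`, an isomorphism of `k`-algebras `A[s; δ] ≅ B[t; δ']` implies `A ≅ B` as `k`-algebras. -/
def IsDeltaCancellative (k : Type u) (A : Type v) [Field k] [Ring A] [Algebra k A] : Prop :=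
  ∀ (B : Type w) [Ring B] [Algebra k B] (δ : AlgDerivation k A) (δ' : AlgDerivation k B),
    Nonempty (OreExt δ ≃ₐ[k] OreExt δ') → Nonempty (A ≃ₐ[k] B)

/-! Transport `d/dt` along the isomorphism to a locally nilpotent derivation `D` of `A[s; δ]`; in
characteristic zero its kernel is the preimage of `B`. It suffices that `ker D = A`, for then the
isomorphism carries `A` onto `B`.

That `D` kills `A` (`apply_incl_eq_zero`) is seen on the degree filtration. As `A` is finitely
generated, `D` raises degrees by a bounded amount, so its leading part is a derivation `a Xⁿ ↦ (∂a +
n a c) Xⁿ⁺ᵐ` of the associated graded ring `A[X]`, again locally nilpotent. There `X` divides its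
own image, which forces `c = 0` because nilpotency degrees add in a domain of characteristic zero.
Then `∂` is locally nilpotent on `A`, hence zero since `ML(A) = A`. So the bound can be lowered
(`RaisesDegreeLT.of_succ`) until `D(A) = 0`.

Conversely, `D ≠ 0` now gives `D s ≠ 0`, and the nilpotency degree of a nonzero element is its
degree in `s` times that of `s`. Only elements of `A` can be killed
(`mem_range_incl_of_apply_eq_zero`). -/

namespace AlgDerivation

/-! ### Nilpotency degrees of locally nilpotent derivations -/

section LocallyNilpotent

variable {k : Type u} {A : Type v} [CommRing k] [Ring A] [Algebra k A] (D : AlgDerivation k A)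

theorem pow_succ_apply (n : ℕ) (a : A) :
    (D.toLinearMap ^ (n + 1)) a = (D.toLinearMap ^ n) (D a) := by
  rw [pow_succ, Module.End.mul_apply]

theorem pow_succ_apply' (n : ℕ) (a : A) :
    (D.toLinearMap ^ (n + 1)) a = D ((D.toLinearMap ^ n) a) := by
  rw [pow_succ', Module.End.mul_apply]

theorem pow_apply_eq_zero_of_le {m n : ℕ} (h : m ≤ n) {a : A}
    (ha : (D.toLinearMap ^ m) a = 0) : (D.toLinearMap ^ n) a = 0 := by
  obtain ⟨r, rfl⟩ := Nat.exists_eq_add_of_le' h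
  rw [pow_add, Module.End.mul_apply, ha, map_zero]

theorem pow_mul_of_apply_left_eq_zero {a : A} (ha : D a = 0) (n : ℕ) (b : A) :
    (D.toLinearMap ^ n) (a * b) = a * (D.toLinearMap ^ n) b := by
  induction n generalizing b with
  | zero => simp
  | succ n ih => rw [pow_succ_apply, leibniz, ha, zero_mul, zero_add, ih, pow_succ_apply]

theorem pow_mul_of_apply_right_eq_zero {b : A} (hb : D b = 0) (n : ℕ) (a : A) :
    (D.toLinearMap ^ n) (a * b) = (D.toLinearMap ^ n) a * b := by
  induction n generalizing a with
  | zero => simp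
  | succ n ih => rw [pow_succ_apply, leibniz, hb, mul_zero, add_zero, ih, pow_succ_apply]

/-- In the Leibniz expansion every other term differentiates one factor too often. The induction is
Pascal's rule, and no commutativity is needed. -/
theorem pow_add_mul (p q : ℕ) (a b : A) (ha : (D.toLinearMap ^ (p + 1)) a = 0)
    (hb : (D.toLinearMap ^ (q + 1)) b = 0) :
    (D.toLinearMap ^ (p + q)) (a * b) =
      (p + q).choose p • ((D.toLinearMap ^ p) a * (D.toLinearMap ^ q) b) := by
  induction p generalizing a q b with
  | zero =>
    have ha' : D a = 0 := by simpa using ha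
    simp [D.pow_mul_of_apply_left_eq_zero ha']
  | succ p ihp =>
    induction q generalizing b with
    | zero =>
      have hb' : D b = 0 := by simpa using hb
      simp [D.pow_mul_of_apply_right_eq_zero hb']
    | succ q ihq =>
      have h1 := ihp (q + 1) (D a) b (by rwa [← pow_succ_apply]) hb
      have h2 := ihq (D b) (by rwa [← pow_succ_apply])
      rw [← pow_succ_apply] at h1 h2
      rw [show p + 1 + (q + 1) = (p + (q + 1)) + 1 by ring, pow_succ_apply, leibniz, map_add, h1,
        show p + (q + 1) = p + 1 + q by ring, h2, ← add_smul, Nat.choose_succ_succ]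

theorem pow_add_succ_mul (p q : ℕ) (a b : A) (ha : (D.toLinearMap ^ (p + 1)) a = 0)
    (hb : (D.toLinearMap ^ (q + 1)) b = 0) :
    (D.toLinearMap ^ (p + q + 1)) (a * b) = 0 := by
  rw [pow_succ_apply', D.pow_add_mul p q a b ha hb, map_nsmul, leibniz, ← pow_succ_apply',
    ← pow_succ_apply', ha, hb, zero_mul, mul_zero, add_zero, smul_zero]

variable {D}

theorem IsLocallyNilpotent.exists_pow_ne_zero (hD : D.IsLocallyNilpotent) {a : A} (ha : a ≠ 0) :
    ∃ p : ℕ, (D.toLinearMap ^ p) a ≠ 0 ∧ (D.toLinearMap ^ (p + 1)) a = 0 := by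
  classical
  have h := hD a
  obtain ⟨p, hp⟩ : ∃ p, Nat.find h = p + 1 := Nat.exists_eq_succ_of_ne_zero fun h0 => ha <| by
    simpa [h0] using Nat.find_spec h
  exact ⟨p, Nat.find_min h (by omega), hp ▸ Nat.find_spec h⟩

theorem pow_add_mul_ne_zero [NoZeroDivisors A] [CharZero A] {p q : ℕ} {a b : A}
    (ha : (D.toLinearMap ^ p) a ≠ 0) (ha' : (D.toLinearMap ^ (p + 1)) a = 0)
    (hb : (D.toLinearMap ^ q) b ≠ 0) (hb' : (D.toLinearMap ^ (q + 1)) b = 0) :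
    (D.toLinearMap ^ (p + q)) (a * b) ≠ 0 := by
  rw [D.pow_add_mul p q a b ha' hb', nsmul_eq_mul]
  exact mul_ne_zero (Nat.cast_ne_zero.2 (Nat.choose_pos (Nat.le_add_right p q)).ne')
    (mul_ne_zero ha hb)

/-- A locally nilpotent derivation of a domain of characteristic zero kills every element that
divides its own derivative. -/
theorem IsLocallyNilpotent.apply_eq_zero_of_eq_mul [NoZeroDivisors A] [CharZero A]
    (hD : D.IsLocallyNilpotent) {x y : A} (h : D x = y * x) : D x = 0 := by
  by_contra h0
  have hy : y ≠ 0 := by rintro rfl; exact h0 (by rw [h, zero_mul])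
  have hx : x ≠ 0 := by rintro rfl; exact h0 (by rw [h, mul_zero])
  obtain ⟨p, hp, hp'⟩ := hD.exists_pow_ne_zero hy
  obtain ⟨q, hq, hq'⟩ := hD.exists_pow_ne_zero hx
  -- By additivity `y * x` has nilpotency degree `p + q`, but as `D x` it must have degree below
  -- `q`.
  refine pow_add_mul_ne_zero hp hp' hq hq' ?_
  rw [← h, ← pow_succ_apply]
  exact D.pow_apply_eq_zero_of_le (by omega) hq'

theorem pow_mul_pow_ne_zero [NoZeroDivisors A] [CharZero A] {p : ℕ} {a : A}
    (ha : (D.toLinearMap ^ p) a ≠ 0) (ha' : (D.toLinearMap ^ (p + 1)) a = 0) (n : ℕ) :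
    (D.toLinearMap ^ (n * p)) (a ^ n) ≠ 0 ∧ (D.toLinearMap ^ (n * p + 1)) (a ^ n) = 0 := by
  induction n with
  | zero => simp [map_one_eq_zero]
  | succ n ih =>
    rw [Nat.succ_mul, pow_succ]
    exact ⟨pow_add_mul_ne_zero ih.1 ih.2 ha ha', D.pow_add_succ_mul _ _ _ _ ih.2 ha'⟩

/-- Transport of a derivation along an isomorphism of algebras. -/
def conj {B : Type w} [Ring B] [Algebra k B] (e : A ≃ₐ[k] B) (D : AlgDerivation k B) :
    AlgDerivation k A where
  toLinearMap := e.symm.toLinearMap ∘ₗ D.toLinearMap ∘ₗ e.toLinearMap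
  leibniz' a b := by
    change e.symm (D (e (a * b))) = e.symm (D (e a)) * b + a * e.symm (D (e b))
    rw [map_mul, leibniz, map_add, map_mul, map_mul, e.symm_apply_apply, e.symm_apply_apply]

theorem conj_apply {B : Type w} [Ring B] [Algebra k B] (e : A ≃ₐ[k] B) (D : AlgDerivation k B)
    (a : A) : conj e D a = e.symm (D (e a)) := rfl

theorem IsLocallyNilpotent.conj {B : Type w} [Ring B] [Algebra k B] (e : A ≃ₐ[k] B)
    {D : AlgDerivation k B} (hD : D.IsLocallyNilpotent) :
    (AlgDerivation.conj e D).IsLocallyNilpotent := by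
  intro a
  obtain ⟨n, hn⟩ := hD (e a)
  have key (m : ℕ) : e (((AlgDerivation.conj e D).toLinearMap ^ m) a) =
      (D.toLinearMap ^ m) (e a) := by
    induction m with
    | zero => simp
    | succ m ih => rw [pow_succ_apply', pow_succ_apply', conj_apply, e.apply_symm_apply, ih]
  exact ⟨n, e.injective (by rw [key, hn, map_zero])⟩

theorem apply_eq_zero_of_makarLimanov_eq_top (hML : makarLimanov k A = ⊤)
    (hD : D.IsLocallyNilpotent) (a : A) : D a = 0 := by
  have ha : a ∈ makarLimanov k A := hML ▸ Algebra.mem_top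
  simp only [makarLimanov, Algebra.mem_iInf] at ha
  exact ha D hD

end LocallyNilpotent

/-! ### Homogeneous derivations of `A[X]` -/

section Polynomial

open Polynomial

variable {k : Type u} {A : Type v} [CommRing k] [Ring A] [Algebra k A]

/-- The homogeneous derivation `a Xⁿ ↦ (D a + n a c) Xⁿ⁺ᵐ` of `A[X]`, for `c` central in `A`. -/
noncomputable def polynomialExtend (D : AlgDerivation k A) (c : A) (hc : ∀ a, c * a = a * c)
    (m : ℕ) : AlgDerivation k A[X] where
  toLinearMap := Polynomial.lsum fun n =>
    (monomial (n + m)).restrictScalars k ∘ₗ (D.toLinearMap + n • LinearMap.mulRight k c)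
  leibniz' p q := by
    simp only [AddHom.toFun_eq_coe, LinearMap.coe_toAddHom]
    induction p using Polynomial.induction_on' with
    | add p₁ p₂ h₁ h₂ => simp only [add_mul, map_add, h₁, h₂]; abel
    | monomial i a =>
      induction q using Polynomial.induction_on' with
      | add q₁ q₂ h₁ h₂ => simp only [mul_add, map_add, h₁, h₂]; abel
      | monomial j b =>
        have hsum (n : ℕ) (a : A) : (monomial n a).sum (fun x₁ x₂ =>
            monomial (x₁ + m) (D x₂ + x₁ • (x₂ * c))) =
              monomial (n + m) (D a + n • (a * c)) := by
          rw [sum_monomial_index]; simp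
        simp only [monomial_mul_monomial, lsum_apply, LinearMap.comp_apply,
          LinearMap.add_apply, LinearMap.smul_apply, LinearMap.mulRight_apply,
          LinearMap.coe_restrictScalars, hsum]
        rw [show i + m + j = i + j + m by ring, show i + (j + m) = i + j + m by ring, ← map_add]
        congr 1
        -- Centrality turns `a * c * b` into `a * b * c`, so the weights `i` and `j` add up.
        rw [leibniz, add_mul, mul_add, smul_mul_assoc, mul_smul_comm, mul_assoc a c b, hc,
          ← mul_assoc, add_smul]
        abel

theorem polynomialExtend_monomial (D : AlgDerivation k A) (c : A) (hc : ∀ a, c * a = a * c)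
    (m n : ℕ) (a : A) :
    polynomialExtend D c hc m (monomial n a) = monomial (n + m) (D a + n • (a * c)) := by
  change Polynomial.lsum _ _ = _
  simp [lsum_apply, sum_monomial_index]

theorem polynomialExtend_isLocallyNilpotent (D : AlgDerivation k A) (c : A)
    (hc : ∀ a, c * a = a * c) (m : ℕ)
    (h : ∀ n a, ∃ j, ((polynomialExtend D c hc m).toLinearMap ^ j) (monomial n a) = 0) :
    (polynomialExtend D c hc m).IsLocallyNilpotent := by
  intro p
  induction p using Polynomial.induction_on' with
  | add p q hp hq =>
    obtain ⟨i, hi⟩ := hp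
    obtain ⟨j, hj⟩ := hq
    refine ⟨max i j, ?_⟩
    rw [map_add, pow_apply_eq_zero_of_le _ (le_max_left i j) hi,
      pow_apply_eq_zero_of_le _ (le_max_right i j) hj, add_zero]
  | monomial n a => exact h n a

/-- If the extension is locally nilpotent on a domain of characteristic zero, then `c = 0`. -/
theorem eq_zero_of_polynomialExtend_isLocallyNilpotent [IsDomain A] [CharZero A]
    (D : AlgDerivation k A) (c : A) (hc : ∀ a, c * a = a * c) (m : ℕ)
    (h : (polynomialExtend D c hc m).IsLocallyNilpotent) : c = 0 := by
  have hX : polynomialExtend D c hc m (monomial 1 1) = monomial m c * monomial 1 1 := by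
    rw [polynomialExtend_monomial, monomial_mul_monomial, map_one_eq_zero, add_comm]
    simp
  have h0 := h.apply_eq_zero_of_eq_mul hX
  rw [hX, monomial_mul_monomial, mul_one] at h0
  exact (monomial_eq_zero_iff _ _).1 h0

theorem isLocallyNilpotent_of_polynomialExtend (D : AlgDerivation k A) (m : ℕ)
    (h : (polynomialExtend D 0 (by simp) m).IsLocallyNilpotent) : D.IsLocallyNilpotent := by
  intro a
  have key (j : ℕ) : ((polynomialExtend D 0 (by simp) m).toLinearMap ^ j) (monomial 0 a) =
      monomial (j * m) ((D.toLinearMap ^ j) a) := by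
    induction j with
    | zero => simp
    | succ j ih =>
      rw [pow_succ_apply', ih, polynomialExtend_monomial, pow_succ_apply', Nat.succ_mul]
      simp
  obtain ⟨j, hj⟩ := h (monomial 0 a)
  exact ⟨j, (monomial_eq_zero_iff _ _).1 (key j ▸ hj)⟩

end Polynomial

end AlgDerivation

/-! ### The degree filtration of `A[t; δ]` -/

namespace OreExt

variable {k : Type u} {A : Type v} [CommRing k] [Ring A] [Algebra k A] (δ : AlgDerivation k A)

/-- The coefficient of `tⁿ`. -/
noncomputable def coeff (n : ℕ) : OreExt δ →ₗ[k] A := (Finsupp.lapply n : (ℕ →₀ A) →ₗ[k] A)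

theorem coeff_monomial (i n : ℕ) (a : A) :
    coeff δ i (monomial δ n a) = if n = i then a else 0 := by
  classical
  exact Finsupp.single_apply

variable {δ} in
theorem ext_coeff {f g : OreExt δ} (h : ∀ n, coeff δ n f = coeff δ n g) : f = g :=
  Finsupp.ext h

theorem monomial_add (n : ℕ) (a b : A) :
    monomial δ n (a + b) = monomial δ n a + monomial δ n b :=
  Finsupp.single_add n a b

theorem monomial_smul (n : ℕ) (r : k) (a : A) : monomial δ n (r • a) = r • monomial δ n a :=
  (Finsupp.smul_single r n a).symm

/-- The inclusion of the coefficient ring. -/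
noncomputable def incl : A →ₐ[k] OreExt δ :=
  AlgHom.ofLinearMap
    { toFun := monomial δ 0
      map_add' := monomial_add δ 0
      map_smul' := monomial_smul δ 0 }
    rfl fun a b => (monomial_zero_mul_monomial δ a b 0).symm

theorem incl_apply (a : A) : incl δ a = monomial δ 0 a := rfl

theorem coeff_zero_incl (a : A) : coeff δ 0 (incl δ a) = a := by
  simp [incl_apply, coeff_monomial]

theorem incl_injective : Function.Injective (incl δ) :=
  Function.LeftInverse.injective (coeff_zero_incl δ)

theorem monomial_one_pow (n : ℕ) : monomial δ 1 1 ^ n = monomial δ n 1 := by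
  induction n with
  | zero => rfl
  | succ n ih => rw [pow_succ', ih, monomial_one_mul_monomial_one]

theorem incl_mul_pow (n : ℕ) (a : A) : incl δ a * monomial δ 1 1 ^ n = monomial δ n a := by
  rw [monomial_one_pow, incl_apply, monomial_zero_mul_monomial, mul_one]

/-- The elements of degree less than `n`. -/
noncomputable def degreeLT (n : ℕ) : Submodule k (OreExt δ) where
  carrier := {f | ∀ i, n ≤ i → coeff δ i f = 0}
  zero_mem' := fun i _ => map_zero _
  add_mem' := fun hf hg i hi => by rw [map_add, hf i hi, hg i hi, add_zero]
  smul_mem' := fun r f hf i hi => by rw [map_smul, hf i hi, smul_zero]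

variable {δ}

theorem degreeLT_mono {m n : ℕ} (h : m ≤ n) : degreeLT δ m ≤ degreeLT δ n :=
  fun _ hf i hi => hf i (h.trans hi)

theorem exists_mem_degreeLT (f : OreExt δ) : ∃ n, f ∈ degreeLT δ n := by
  refine ⟨(Finsupp.support (α := ℕ) (M := A) f).sup id + 1, fun i hi => ?_⟩
  by_contra h
  have := Finset.le_sup (f := id) (Finsupp.mem_support_iff (f := (f : ℕ →₀ A)).2 h)
  simp only [id] at this
  omega

theorem monomial_mem_degreeLT (n : ℕ) (a : A) : monomial δ n a ∈ degreeLT δ (n + 1) := by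
  intro i hi
  rw [coeff_monomial, if_neg (by omega)]

theorem incl_mem_degreeLT (a : A) : incl δ a ∈ degreeLT δ 1 := monomial_mem_degreeLT 0 a

theorem eq_zero_of_mem_degreeLT_zero {f : OreExt δ} (hf : f ∈ degreeLT δ 0) : f = 0 :=
  ext_coeff fun n => by rw [hf n (Nat.zero_le n), map_zero]

theorem mem_degreeLT_of_succ {n : ℕ} {f : OreExt δ} (hf : f ∈ degreeLT δ (n + 1))
    (h : coeff δ n f = 0) : f ∈ degreeLT δ n := by
  intro i hi
  rcases hi.eq_or_lt with rfl | hi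
  · exact h
  · exact hf i hi

theorem sub_monomial_mem_degreeLT {n : ℕ} {f : OreExt δ} (hf : f ∈ degreeLT δ (n + 1)) :
    f - monomial δ n (coeff δ n f) ∈ degreeLT δ n :=
  mem_degreeLT_of_succ (sub_mem hf (monomial_mem_degreeLT n _)) <| by
    rw [map_sub, coeff_monomial, if_pos rfl, sub_self]

theorem eq_incl_of_mem_degreeLT_one {f : OreExt δ} (hf : f ∈ degreeLT δ 1) :
    f = incl δ (coeff δ 0 f) :=
  sub_eq_zero.1 (eq_zero_of_mem_degreeLT_zero (sub_monomial_mem_degreeLT hf))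

theorem exists_leading {f : OreExt δ} (hf : f ≠ 0) :
    ∃ n, f ∈ degreeLT δ (n + 1) ∧ coeff δ n f ≠ 0 := by
  classical
  have h := exists_mem_degreeLT f
  obtain ⟨n, hn⟩ : ∃ n, Nat.find h = n + 1 := Nat.exists_eq_succ_of_ne_zero fun h0 =>
    hf <| eq_zero_of_mem_degreeLT_zero (h0 ▸ Nat.find_spec h)
  have hn' := Nat.find_spec h
  rw [hn] at hn'
  exact ⟨n, hn', fun h0 => Nat.find_min h (by omega : n < _) (mem_degreeLT_of_succ hn' h0)⟩

/-- Induction on the degree: additive statements hold for all elements as soon as they hold for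
all `a tⁿ`. -/
theorem induction_monomial {P : OreExt δ → Prop} (h0 : P 0)
    (hadd : ∀ f g, P f → P g → P (f + g)) (hmon : ∀ n a, P (monomial δ n a)) (f : OreExt δ) :
    P f :=
  Finsupp.induction_linear (motive := P) f h0 hadd hmon

theorem variable_mul_monomial (n : ℕ) (a : A) :
    monomial δ 1 1 * monomial δ n a = monomial δ (n + 1) a + monomial δ n (δ a) :=
  (mulLeft_single δ 1 1 _).trans (by rw [one_smul, pow_one]; exact mulT_single δ n a)

theorem coeff_succ_variable_mul (g : OreExt δ) (i : ℕ) :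
    coeff δ (i + 1) (monomial δ 1 1 * g) = coeff δ i g + δ (coeff δ (i + 1) g) := by
  induction g using induction_monomial with
  | h0 => simp
  | hadd f g hf hg => simp only [mul_add, map_add, hf, hg]; abel
  | hmon n a =>
    rw [variable_mul_monomial]
    simp only [map_add, coeff_monomial, add_left_inj]
    split_ifs <;> simp_all

theorem coeff_incl_mul (a : A) (g : OreExt δ) (i : ℕ) :
    coeff δ i (incl δ a * g) = a * coeff δ i g := by
  induction g using induction_monomial with
  | h0 => simp
  | hadd f g hf hg => simp only [mul_add, map_add, hf, hg]
  | hmon n b =>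
    rw [incl_apply, monomial_zero_mul_monomial, coeff_monomial, coeff_monomial]
    split_ifs <;> simp

/-- The correction by `δ` stays in degree at most `m`, so it does not reach the leading coefficient.
-/
theorem variable_mul_leading {m : ℕ} {g : OreExt δ} (hg : g ∈ degreeLT δ (m + 1)) :
    monomial δ 1 1 * g ∈ degreeLT δ (m + 1 + 1) ∧
      coeff δ (m + 1) (monomial δ 1 1 * g) = coeff δ m g := by
  constructor
  · intro i hi
    obtain ⟨i, rfl⟩ := Nat.exists_eq_succ_of_ne_zero (by omega : i ≠ 0)
    rw [Nat.succ_eq_add_one, coeff_succ_variable_mul, hg i (by omega), hg (i + 1) (by omega),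
      map_zero, add_zero]
  · rw [coeff_succ_variable_mul, hg (m + 1) le_rfl, map_zero, add_zero]

theorem variable_pow_mul_leading (n : ℕ) {m : ℕ} {g : OreExt δ} (hg : g ∈ degreeLT δ (m + 1)) :
    monomial δ 1 1 ^ n * g ∈ degreeLT δ (n + m + 1) ∧
      coeff δ (n + m) (monomial δ 1 1 ^ n * g) = coeff δ m g := by
  induction n with
  | zero => simpa using hg
  | succ n ih =>
    have h := variable_mul_leading ih.1
    rw [pow_succ', mul_assoc, show n + 1 + m = n + m + 1 by ring]
    exact ⟨h.1, h.2.trans ih.2⟩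

theorem monomial_mul_leading (n : ℕ) (a : A) {m : ℕ} {g : OreExt δ}
    (hg : g ∈ degreeLT δ (m + 1)) :
    monomial δ n a * g ∈ degreeLT δ (n + m + 1) ∧
      coeff δ (n + m) (monomial δ n a * g) = a * coeff δ m g := by
  have h := variable_pow_mul_leading n hg
  rw [← incl_mul_pow, mul_assoc, coeff_incl_mul, h.2]
  exact ⟨fun i hi => by rw [coeff_incl_mul, h.1 i hi, mul_zero], rfl⟩

theorem mul_mem_degreeLT_of_lt {n m : ℕ} {f g : OreExt δ} (hf : f ∈ degreeLT δ n)
    (hg : g ∈ degreeLT δ (m + 1)) : f * g ∈ degreeLT δ (n + m) := by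
  induction n generalizing f with
  | zero => rw [eq_zero_of_mem_degreeLT_zero hf, zero_mul]; exact zero_mem _
  | succ n ih =>
    rw [← sub_add_cancel f (monomial δ n (coeff δ n f)), add_mul,
      show n + 1 + m = n + m + 1 by ring]
    exact add_mem (degreeLT_mono (Nat.le_succ _) (ih (sub_monomial_mem_degreeLT hf)))
      (monomial_mul_leading n _ hg).1

theorem mul_mem_degreeLT {n m : ℕ} {f g : OreExt δ} (hf : f ∈ degreeLT δ (n + 1))
    (hg : g ∈ degreeLT δ (m + 1)) : f * g ∈ degreeLT δ (n + m + 1) := by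
  rw [show n + m + 1 = n + 1 + m by ring]
  exact mul_mem_degreeLT_of_lt hf hg

/-- Leading coefficients multiply. -/
theorem coeff_add_mul {n m : ℕ} {f g : OreExt δ} (hf : f ∈ degreeLT δ (n + 1))
    (hg : g ∈ degreeLT δ (m + 1)) : coeff δ (n + m) (f * g) = coeff δ n f * coeff δ m g := by
  conv_lhs => rw [← sub_add_cancel f (monomial δ n (coeff δ n f)), add_mul, map_add]
  rw [(monomial_mul_leading n _ hg).2,
    mul_mem_degreeLT_of_lt (sub_monomial_mem_degreeLT hf) hg _ le_rfl, zero_add]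

theorem coeff_mul_incl {n : ℕ} {f : OreExt δ} (hf : f ∈ degreeLT δ (n + 1)) (a : A) :
    coeff δ n (f * incl δ a) = coeff δ n f * a := by
  have := coeff_add_mul hf (incl_mem_degreeLT (δ := δ) a)
  rwa [add_zero, coeff_zero_incl] at this

theorem mul_incl_mem_degreeLT {n : ℕ} {f : OreExt δ} (hf : f ∈ degreeLT δ n) (a : A) :
    f * incl δ a ∈ degreeLT δ n :=
  mul_mem_degreeLT_of_lt hf (incl_mem_degreeLT a)

theorem incl_mul_mem_degreeLT {n : ℕ} {f : OreExt δ} (hf : f ∈ degreeLT δ n) (a : A) :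
    incl δ a * f ∈ degreeLT δ n :=
  fun i hi => by rw [coeff_incl_mul, hf i hi, mul_zero]

instance [NoZeroDivisors A] : NoZeroDivisors (OreExt δ) where
  eq_zero_or_eq_zero_of_mul_eq_zero {f g} h := by
    by_contra! hfg
    obtain ⟨n, hn, hn'⟩ := exists_leading hfg.1
    obtain ⟨m, hm, hm'⟩ := exists_leading hfg.2
    have := coeff_add_mul hn hm
    rw [h, map_zero] at this
    exact mul_ne_zero hn' hm' this.symm

instance [CharZero A] : CharZero (OreExt δ) :=
  charZero_of_injective_ringHom (f := (incl δ).toRingHom) (incl_injective δ)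

/-! ### The derivation `d/dt` and its kernel -/

variable (δ)

/-- The linear map `a tⁿ ↦ n a tⁿ⁻¹`. -/
noncomputable def derivativeLinear : OreExt δ →ₗ[k] OreExt δ :=
  (Finsupp.lsum k fun n => n • (Finsupp.lsingle (n - 1) : A →ₗ[k] ℕ →₀ A) :
    (ℕ →₀ A) →ₗ[k] (ℕ →₀ A))

theorem derivativeLinear_monomial (n : ℕ) (a : A) :
    derivativeLinear δ (monomial δ n a) = n • monomial δ (n - 1) a := by
  refine (Finsupp.lsum_single (R := k) (S := k) (N := ℕ →₀ A) _ n a).trans ?_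
  rfl

theorem derivativeLinear_incl_mul (a : A) (g : OreExt δ) :
    derivativeLinear δ (incl δ a * g) = incl δ a * derivativeLinear δ g := by
  induction g using induction_monomial with
  | h0 => simp
  | hadd f g hf hg => simp only [mul_add, map_add, hf, hg]
  | hmon n b =>
    rw [incl_apply, monomial_zero_mul_monomial, derivativeLinear_monomial,
      derivativeLinear_monomial, mul_smul_comm, monomial_zero_mul_monomial]

/-- The Weyl relation survives the twist because `d/dt` commutes with applying `δ` to coefficients.
-/
theorem derivativeLinear_variable_mul (g : OreExt δ) :
    derivativeLinear δ (monomial δ 1 1 * g) = g + monomial δ 1 1 * derivativeLinear δ g := by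
  induction g using induction_monomial with
  | h0 => simp
  | hadd f g hf hg => simp only [mul_add, map_add, hf, hg]; abel
  | hmon n b =>
    rw [variable_mul_monomial, map_add, derivativeLinear_monomial, derivativeLinear_monomial,
      derivativeLinear_monomial, mul_smul_comm, variable_mul_monomial, Nat.add_sub_cancel]
    -- The truncated exponent `0 - 1` is harmless: its scalar is `0`.
    rcases n with _ | n
    · simp
    · rw [Nat.add_sub_cancel, smul_add, succ_nsmul' (monomial δ (n + 1) b) (n + 1)]
      abel

theorem derivativeLinear_pow_mul (n : ℕ) (g : OreExt δ) :
    derivativeLinear δ (monomial δ 1 1 ^ n * g) =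
      n • (monomial δ 1 1 ^ (n - 1) * g) + monomial δ 1 1 ^ n * derivativeLinear δ g := by
  induction n with
  | zero => simp
  | succ n ih =>
    rw [pow_succ', mul_assoc, derivativeLinear_variable_mul, ih, Nat.add_sub_cancel, mul_add,
      ← add_assoc, mul_assoc]
    congr 1
    rcases n with _ | n
    · simp
    · rw [Nat.add_sub_cancel, mul_smul_comm, ← mul_assoc, ← pow_succ', succ_nsmul' _ (n + 1)]

/-- The derivation `d/dt`, killing the coefficients and mapping `t` to `1`. -/
noncomputable def derivative : AlgDerivation k (OreExt δ) where
  toLinearMap := derivativeLinear δ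
  leibniz' f g := by
    simp only [AddHom.toFun_eq_coe, LinearMap.coe_toAddHom]
    induction f using induction_monomial with
    | h0 => simp
    | hadd f g hf hg => simp only [add_mul, map_add, hf, hg]; abel
    | hmon n a =>
      rw [derivativeLinear_monomial, ← incl_mul_pow δ n, ← incl_mul_pow δ (n - 1), mul_assoc,
        derivativeLinear_incl_mul, derivativeLinear_pow_mul, mul_add, mul_smul_comm,
        smul_mul_assoc, mul_assoc, mul_assoc]

theorem derivative_monomial (n : ℕ) (a : A) :
    derivative δ (monomial δ n a) = n • monomial δ (n - 1) a :=
  derivativeLinear_monomial δ n a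

theorem coeff_derivative (f : OreExt δ) (n : ℕ) :
    coeff δ n (derivative δ f) = (n + 1) • coeff δ (n + 1) f := by
  induction f using induction_monomial with
  | h0 => simp
  | hadd f g hf hg => simp only [map_add, smul_add, hf, hg]
  | hmon m b =>
    rw [derivative_monomial, map_nsmul, coeff_monomial, coeff_monomial]
    rcases m with _ | m
    · simp
    · simp only [Nat.add_sub_cancel, Nat.add_right_cancel_iff]
      split_ifs with h
      · rw [h]
      · simp

theorem derivative_isLocallyNilpotent : (derivative δ).IsLocallyNilpotent := by
  intro f
  obtain ⟨n, hn⟩ := exists_mem_degreeLT f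
  refine ⟨n, ?_⟩
  induction n generalizing f with
  | zero => exact eq_zero_of_mem_degreeLT_zero hn
  | succ n ih =>
    rw [AlgDerivation.pow_succ_apply]
    exact ih _ fun i hi => by rw [coeff_derivative, hn (i + 1) (by omega), smul_zero]

/-- The coefficients of the derivative are `(i + 1)` times those of `f`, and torsion-freeness
cancels `i + 1`. -/
theorem derivative_eq_zero_iff [IsAddTorsionFree A] (f : OreExt δ) :
    derivative δ f = 0 ↔ f ∈ (incl δ).range := by
  constructor
  · intro h
    have hf : f ∈ degreeLT δ 1 := by
      intro i hi
      obtain ⟨i, rfl⟩ := Nat.exists_eq_succ_of_ne_zero (by omega : i ≠ 0)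
      have := coeff_derivative δ f i
      rw [h, map_zero] at this
      exact (smul_eq_zero_iff_right (Nat.succ_ne_zero i)).1 this.symm
    exact ⟨_, (eq_incl_of_mem_degreeLT_one hf).symm⟩
  · rintro ⟨a, rfl⟩
    change derivative δ (monomial δ 0 a) = 0
    rw [derivative_monomial, zero_smul]

/-! ### Leading parts of derivations of `A[t; δ]` -/

section LocallyNilpotent

variable {δ}

/-- A derivation of `A[t; δ]` raises degrees by less than `m` on the generators. -/
def RaisesDegreeLT (D : AlgDerivation k (OreExt δ)) (m : ℕ) : Prop :=
  (∀ a, D (incl δ a) ∈ degreeLT δ m) ∧ D (monomial δ 1 1) ∈ degreeLT δ (m + 1)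

/-- A bound on finitely many generators extends to all of `A` by Leibniz, since multiplying by
coefficients does not raise degree. -/
theorem exists_raisesDegreeLT (hA : Algebra.FiniteType k A) (D : AlgDerivation k (OreExt δ)) :
    ∃ m, RaisesDegreeLT D m := by
  obtain ⟨S, hS⟩ := hA.out
  choose d hd using fun f : OreExt δ => exists_mem_degreeLT f
  refine ⟨S.sup (fun a => d (D (incl δ a))) + d (D (monomial δ 1 1)), fun a => ?_,
    degreeLT_mono (by omega) (hd _)⟩
  have ha : a ∈ Algebra.adjoin k (S : Set A) := hS ▸ Algebra.mem_top
  induction ha using Algebra.adjoin_induction with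
  | mem a ha =>
    exact degreeLT_mono ((Finset.le_sup (f := fun a => d (D (incl δ a))) ha).trans
      (Nat.le_add_right _ _)) (hd _)
  | algebraMap r =>
    rw [AlgHom.commutes, AlgDerivation.map_algebraMap_eq_zero]
    exact zero_mem _
  | add a b _ _ ha hb => rw [map_add, map_add]; exact add_mem ha hb
  | mul a b _ _ ha hb =>
    rw [map_mul, AlgDerivation.leibniz]
    exact add_mem (mul_incl_mem_degreeLT ha b) (incl_mul_mem_degreeLT hb a)

variable {D : AlgDerivation k (OreExt δ)} {m : ℕ}

/-- The leading part of a derivation of `A[t; δ]` on the coefficients. -/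
noncomputable def leadingDerivation (hD : RaisesDegreeLT D (m + 1)) : AlgDerivation k A where
  toLinearMap := coeff δ m ∘ₗ D.toLinearMap ∘ₗ (incl δ).toLinearMap
  leibniz' a b := by
    change coeff δ m (D (incl δ (a * b))) =
      coeff δ m (D (incl δ a)) * b + a * coeff δ m (D (incl δ b))
    rw [map_mul, AlgDerivation.leibniz, map_add, coeff_mul_incl (hD.1 a), coeff_incl_mul]

theorem leadingDerivation_apply (hD : RaisesDegreeLT D (m + 1)) (a : A) :
    leadingDerivation hD a = coeff δ m (D (incl δ a)) := rfl

theorem variable_mem_degreeLT : monomial δ 1 1 ∈ degreeLT δ (1 + 1) := monomial_mem_degreeLT 1 1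

/-- The leading coefficient of the image of `t` is central. -/
theorem leading_variable_comm (hD : RaisesDegreeLT D (m + 1)) (a : A) :
    coeff δ (m + 1) (D (monomial δ 1 1)) * a = a * coeff δ (m + 1) (D (monomial δ 1 1)) := by
  -- Apply `D` to `t a = a t + δ(a)` in degree `m + 1`: `t D(a)` and `D(a) t` contribute equally,
  -- and `D(δ a)` has lower degree.
  have h := congrArg (fun f => coeff δ (m + 1) (D f)) (variable_mul_coeff δ a)
  simp only [← incl_apply, AlgDerivation.leibniz, map_add] at h
  have h1 := coeff_add_mul (variable_mem_degreeLT (δ := δ)) (hD.1 a)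
  have h2 := coeff_add_mul (hD.1 a) (variable_mem_degreeLT (δ := δ))
  rw [coeff_monomial, if_pos rfl] at h1 h2
  rw [add_comm 1 m] at h1
  rw [coeff_mul_incl hD.2, h1, h2, coeff_incl_mul, hD.1 (δ a) _ le_rfl, one_mul,
    mul_one, add_zero, add_comm] at h
  exact add_left_cancel h

theorem apply_variable_pow (hD : RaisesDegreeLT D (m + 1)) (n : ℕ) :
    D (monomial δ 1 1 ^ n) ∈ degreeLT δ (n + m + 1) ∧
      coeff δ (n + m) (D (monomial δ 1 1 ^ n)) =
        n • coeff δ (m + 1) (D (monomial δ 1 1)) := by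
  induction n with
  | zero => simp [AlgDerivation.map_one_eq_zero]
  | succ n ih =>
    have hn : (monomial δ 1 1 : OreExt δ) ^ n ∈ degreeLT δ (n + 1) := by
      rw [monomial_one_pow]; exact monomial_mem_degreeLT n 1
    have e1 : n + 1 + m = n + m + 1 := by ring
    have e2 : n + 1 + m = n + (m + 1) := by ring
    rw [pow_succ, AlgDerivation.leibniz]
    constructor
    · refine add_mem ?_ ?_
      · rw [e1]; exact mul_mem_degreeLT ih.1 variable_mem_degreeLT
      · rw [e2]; exact mul_mem_degreeLT hn hD.2
    · have h1 := coeff_add_mul ih.1 (variable_mem_degreeLT (δ := δ))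
      have h2 := coeff_add_mul hn hD.2
      rw [← e1, ih.2, coeff_monomial, if_pos rfl, mul_one] at h1
      rw [← e2, monomial_one_pow, coeff_monomial, if_pos rfl, one_mul, ← monomial_one_pow] at h2
      rw [map_add, h1, h2, succ_nsmul]

/-- This matches the formula of `polynomialExtend`, which identifies the action of `D` on leading
terms. -/
theorem apply_monomial (hD : RaisesDegreeLT D (m + 1)) (n : ℕ) (a : A) :
    D (monomial δ n a) ∈ degreeLT δ (n + m + 1) ∧
      coeff δ (n + m) (D (monomial δ n a)) =
        leadingDerivation hD a + n • (a * coeff δ (m + 1) (D (monomial δ 1 1))) := by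
  have hn : (monomial δ 1 1 : OreExt δ) ^ n ∈ degreeLT δ (n + 1) := by
    rw [monomial_one_pow]; exact monomial_mem_degreeLT n 1
  rw [← incl_mul_pow, AlgDerivation.leibniz]
  constructor
  · refine add_mem ?_ (incl_mul_mem_degreeLT (apply_variable_pow hD n).1 a)
    rw [add_comm n m]
    exact mul_mem_degreeLT (hD.1 a) hn
  · have h1 := coeff_add_mul (hD.1 a) hn
    rw [add_comm m n, monomial_one_pow, coeff_monomial, if_pos rfl, mul_one,
      ← monomial_one_pow] at h1
    rw [map_add, h1, coeff_incl_mul, (apply_variable_pow hD n).2, mul_smul_comm,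
      leadingDerivation_apply]

theorem apply_mem_degreeLT (hD : RaisesDegreeLT D (m + 1)) {n : ℕ} {f : OreExt δ}
    (hf : f ∈ degreeLT δ n) : D f ∈ degreeLT δ (n + m) := by
  induction n generalizing f with
  | zero => rw [eq_zero_of_mem_degreeLT_zero hf, map_zero]; exact zero_mem _
  | succ n ih =>
    rw [← sub_add_cancel f (monomial δ n (coeff δ n f)), map_add, Nat.add_right_comm]
    exact add_mem (degreeLT_mono (Nat.le_succ _) (ih (sub_monomial_mem_degreeLT hf)))
      (apply_monomial hD n _).1

theorem coeff_apply (hD : RaisesDegreeLT D (m + 1)) {n : ℕ} {f : OreExt δ}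
    (hf : f ∈ degreeLT δ (n + 1)) :
    coeff δ (n + m) (D f) = leadingDerivation hD (coeff δ n f) +
      n • (coeff δ n f * coeff δ (m + 1) (D (monomial δ 1 1))) := by
  conv_lhs => rw [← sub_add_cancel f (monomial δ n (coeff δ n f)), map_add, map_add]
  rw [(apply_monomial hD n _).2,
    apply_mem_degreeLT hD (sub_monomial_mem_degreeLT hf) _ le_rfl, zero_add]

/-- The derivation induced on the associated graded ring `A[X]` by the leading part. -/
theorem graded_isLocallyNilpotent (hD : RaisesDegreeLT D (m + 1)) (hnil : D.IsLocallyNilpotent) :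
    ((leadingDerivation hD).polynomialExtend _ (leading_variable_comm hD)
      m).IsLocallyNilpotent := by
  refine AlgDerivation.polynomialExtend_isLocallyNilpotent _ _ _ _ fun n a => ?_
  obtain ⟨j, hj⟩ := hnil (monomial δ n a)
  -- The coefficient in degree `n + i * m` may vanish; the identity still holds, both sides being
  -- zero.
  have key (i : ℕ) : (D.toLinearMap ^ i) (monomial δ n a) ∈ degreeLT δ (n + i * m + 1) ∧
      (((leadingDerivation hD).polynomialExtend _ (leading_variable_comm hD) m).toLinearMap ^ i)
        (Polynomial.monomial n a) = Polynomial.monomial (n + i * m)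
          (coeff δ (n + i * m) ((D.toLinearMap ^ i) (monomial δ n a))) := by
    induction i with
    | zero => simpa [coeff_monomial] using monomial_mem_degreeLT n a
    | succ i ih =>
      rw [AlgDerivation.pow_succ_apply', AlgDerivation.pow_succ_apply', ih.2,
        AlgDerivation.polynomialExtend_monomial, ← coeff_apply hD ih.1,
        show n + (i + 1) * m = n + i * m + m by ring, Nat.add_right_comm _ m 1]
      exact ⟨apply_mem_degreeLT hD ih.1, rfl⟩
  exact ⟨j, by rw [(key j).2, hj, map_zero, map_zero]⟩

/-- The descent step: `c = 0` by divisibility in `A[X]`, and only then is `∂` known to be locally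
nilpotent and killed by the hypothesis on `ML(A)`. -/
theorem RaisesDegreeLT.of_succ [IsDomain A] [CharZero A] (hML : makarLimanov k A = ⊤)
    (hD : RaisesDegreeLT D (m + 1)) (hnil : D.IsLocallyNilpotent) : RaisesDegreeLT D m := by
  have h := graded_isLocallyNilpotent hD hnil
  have hc := AlgDerivation.eq_zero_of_polynomialExtend_isLocallyNilpotent _ _ _ _ h
  simp only [hc] at h
  have h0 := AlgDerivation.apply_eq_zero_of_makarLimanov_eq_top hML
    (AlgDerivation.isLocallyNilpotent_of_polynomialExtend _ _ h)
  exact ⟨fun a => mem_degreeLT_of_succ (hD.1 a) (h0 a), mem_degreeLT_of_succ hD.2 hc⟩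

/-- If `A` is an affine domain with `ML(A) = A`, every locally nilpotent derivation of `A[t; δ]`
kills `A`. -/
theorem apply_incl_eq_zero [IsDomain A] [CharZero A] (hA : Algebra.FiniteType k A)
    (hML : makarLimanov k A = ⊤) (hnil : D.IsLocallyNilpotent) (a : A) : D (incl δ a) = 0 := by
  obtain ⟨m, hm⟩ := exists_raisesDegreeLT hA D
  have h0 : RaisesDegreeLT D 0 := by
    induction m with
    | zero => exact hm
    | succ m ih => exact ih (hm.of_succ hML hnil)
  exact eq_zero_of_mem_degreeLT_zero (h0.1 a)

/-! ### Kernels of derivations killing `A` -/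

theorem pow_apply_eq_zero_of_mem_degreeLT [NoZeroDivisors A] [CharZero A]
    (h0 : ∀ a, D (incl δ a) = 0) {p : ℕ} (hp0 : (D.toLinearMap ^ p) (monomial δ 1 1) ≠ 0)
    (hp : (D.toLinearMap ^ (p + 1)) (monomial δ 1 1) = 0) (hpos : 0 < p) {n : ℕ} {f : OreExt δ}
    (hf : f ∈ degreeLT δ n) : (D.toLinearMap ^ (n * p)) f = 0 := by
  induction n generalizing f with
  | zero => rw [eq_zero_of_mem_degreeLT_zero hf, map_zero]
  | succ n ih =>
    rw [← sub_add_cancel f (monomial δ n (coeff δ n f)), map_add,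
      D.pow_apply_eq_zero_of_le (Nat.mul_le_mul_right p (Nat.le_succ n))
        (ih (sub_monomial_mem_degreeLT hf)), ← incl_mul_pow,
      D.pow_mul_of_apply_left_eq_zero (h0 _),
      -- `tⁿ` dies at the power `n * p + 1`, which is at most `(n + 1) * p` because `p > 0`.
      D.pow_apply_eq_zero_of_le (by rw [Nat.succ_mul]; omega)
        (AlgDerivation.pow_mul_pow_ne_zero hp0 hp n).2, mul_zero, add_zero]

/-- The power `n * p` kills all lower terms, while the leading term survives. -/
theorem pow_apply_ne_zero_of_coeff_ne_zero [NoZeroDivisors A] [CharZero A]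
    (h0 : ∀ a, D (incl δ a) = 0) {p : ℕ} (hp0 : (D.toLinearMap ^ p) (monomial δ 1 1) ≠ 0)
    (hp : (D.toLinearMap ^ (p + 1)) (monomial δ 1 1) = 0) (hpos : 0 < p) {n : ℕ} {f : OreExt δ}
    (hf : f ∈ degreeLT δ (n + 1)) (hfn : coeff δ n f ≠ 0) : (D.toLinearMap ^ (n * p)) f ≠ 0 := by
  rw [← sub_add_cancel f (monomial δ n (coeff δ n f)), map_add,
    pow_apply_eq_zero_of_mem_degreeLT h0 hp0 hp hpos (sub_monomial_mem_degreeLT hf), zero_add,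
    ← incl_mul_pow, D.pow_mul_of_apply_left_eq_zero (h0 _)]
  exact mul_ne_zero ((map_ne_zero_iff _ (incl_injective δ)).2 hfn)
    (AlgDerivation.pow_mul_pow_ne_zero hp0 hp n).1

theorem apply_eq_zero_of_variable (h0 : ∀ a, D (incl δ a) = 0) (hX : D (monomial δ 1 1) = 0)
    (f : OreExt δ) : D f = 0 := by
  have hmem : ∀ n, monomial δ 1 1 ^ n ∈ D.ker := fun n => pow_mem (show _ ∈ D.ker from hX) n
  induction f using induction_monomial with
  | h0 => exact map_zero _
  | hadd f g hf hg => rw [map_add, hf, hg, add_zero]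
  | hmon n a =>
    rw [← incl_mul_pow, AlgDerivation.leibniz, h0, show D (monomial δ 1 1 ^ n) = 0 from hmem n,
      zero_mul, mul_zero, add_zero]

/-- The kernel of a nonzero locally nilpotent derivation killing `A` is contained in `A`. -/
theorem mem_range_incl_of_apply_eq_zero [NoZeroDivisors A] [CharZero A]
    (hnil : D.IsLocallyNilpotent) (h0 : ∀ a, D (incl δ a) = 0) (hne : ∃ f, D f ≠ 0)
    {f : OreExt δ} (hf : D f = 0) : f ∈ (incl δ).range := by
  have hX : D (monomial δ 1 1) ≠ 0 := fun hX =>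
    let ⟨g, hg⟩ := hne
    hg (apply_eq_zero_of_variable h0 hX g)
  obtain ⟨p, hp0, hp⟩ := hnil.exists_pow_ne_zero (a := monomial δ 1 1) fun h =>
    hX (by rw [h, map_zero])
  have hpos : 0 < p := Nat.pos_of_ne_zero fun h => hX (by simpa [h] using hp)
  rcases eq_or_ne f 0 with rfl | hf0
  · exact zero_mem _
  obtain ⟨n, hn, hn'⟩ := exists_leading hf0
  rcases n with _ | n
  · exact ⟨_, (eq_incl_of_mem_degreeLT_one hn).symm⟩
  -- In positive degree some `D ^ j` with `j ≥ 1` does not kill `f`, against `D f = 0`.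
  · refine absurd ?_ (pow_apply_ne_zero_of_coeff_ne_zero h0 hp0 hp hpos hn hn')
    exact D.pow_apply_eq_zero_of_le (m := 1) (by rw [Nat.succ_mul]; omega) (by simpa using hf)

end LocallyNilpotent

end OreExt

/-! ### Cancellation -/

theorem theorem5p4 {k : Type u} [Field k] [CharZero k]
    {A : Type v} [Ring A] [IsDomain A] [Algebra k A]
    (hAffine : Algebra.FiniteType k A)
    (hGK : gkDim k A < ⊤)
    (hML : makarLimanov k A = ⊤) :
    IsDeltaCancellative.{u, v, w} k A := by
  rintro B _ _ δ δ' ⟨e⟩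
  have : CharZero A := charZero_of_injective_algebraMap (algebraMap k A).injective
  -- If `B` were zero, so would be both Ore extensions. Nontriviality makes `d/dt` nonzero, as it
  -- sends `t` to `1`.
  have : Nontrivial B := by
    by_contra h
    rw [not_nontrivial_iff_subsingleton] at h
    have h1 : (1 : OreExt δ') = 0 := by
      rw [← map_one (OreExt.incl δ'), Subsingleton.elim (1 : B) 0, map_zero]
    have h2 := congrArg e.symm h1
    rw [map_one, map_zero, ← map_one (OreExt.incl δ)] at h2
    exact one_ne_zero (OreExt.incl_injective δ (h2.trans (map_zero _).symm))
  have : Module ℚ B := Module.compHom B (algebraMap ℚ k)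
  have : IsAddTorsionFree B := IsAddTorsionFree.of_module_rat B
  set D := AlgDerivation.conj e (OreExt.derivative δ') with hDdef
  have hnil : D.IsLocallyNilpotent := (OreExt.derivative_isLocallyNilpotent δ').conj e
  have h0 : ∀ a, D (OreExt.incl δ a) = 0 := OreExt.apply_incl_eq_zero hAffine hML hnil
  have hker (f : OreExt δ) : D f = 0 ↔ e f ∈ (OreExt.incl δ').range := by
    rw [← OreExt.derivative_eq_zero_iff, hDdef, AlgDerivation.conj_apply,
      EmbeddingLike.map_eq_zero_iff]
  have hne : ∃ f, D f ≠ 0 := by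
    refine ⟨e.symm (OreExt.monomial δ' 1 1), ?_⟩
    rw [hDdef, AlgDerivation.conj_apply, e.apply_symm_apply, OreExt.derivative_monomial, one_smul,
      Ne, EmbeddingLike.map_eq_zero_iff]
    exact fun h => one_ne_zero (OreExt.incl_injective δ' (h.trans (map_zero _).symm))
  -- Both sides are the image of `ker D` under `e`.
  have hrange : (OreExt.incl δ).range.map e.toAlgHom = (OreExt.incl δ').range := by
    ext g
    constructor
    · rintro ⟨_, ⟨a, rfl⟩, rfl⟩
      exact (hker _).1 (h0 a)
    · intro hg
      refine ⟨e.symm g, OreExt.mem_range_incl_of_apply_eq_zero hnil h0 hne ?_,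
        e.apply_symm_apply g⟩
      rwa [hker, e.apply_symm_apply]
  exact ⟨(((AlgEquiv.ofInjective _ (OreExt.incl_injective δ)).trans
    (AlgEquiv.subalgebraMap e _)).trans (Subalgebra.equivOfEq _ _ hrange)).trans
    (AlgEquiv.ofInjective _ (OreExt.incl_injective δ')).symm⟩
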